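/- Let $R$ be a ring with $1$ and $T$ a tilting right $R$-module, that is, a right $R$-module with $\mathrm{Gen}\,T=T^\perp$. Here $T^\perp$ is the class of all right $R$-modules $M$ with $\mathrm{Ext}^1_R(T,M)=0$, $\mathrm{Gen}\,T$ is the class of all epimorphic images of direct sums of copies of $T$, and $\mathrm{Add}\,T$ is the class of all modules isomorphic to direct summands of direct sums of copies of $T$. Two tilting modules $T,T'$ are equivalent if $T^\perp=T'^\perp$. The following statements are equivalent. (1) There is an injective ring epimorphism $\lambda:R\to S$ such that $\mathrm{Tor}_1^R(S,S)=0$ and $S\oplus S/R$ is a tilting right $R$-module equivalent to $T$. (2) There is an exact sequence $0\to R\xrightarrow{a}T_0\to T_1\to 0$ of right $R$-modules such that $T_0,T_1\in\mathrm{Add}\,T$ and $\mathrm{Hom}_R(T_1,T_0)=0$. Moreover, for every exact sequence as in (2), the map $a:R\to T_0$ is a $T^\perp$-envelope of $R$; that is, $T_0\in T^\perp$, every homomorphism from $R$ to a module in $T^\perp$ factors through $a$, and every endomorphism $g$ of $T_0$ with $ga=a$ is an automorphism. And for every $\lambda$ as in (1), $\lambda$ is a homological ring epimorphism, that is, a ring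 epimorphism with $\mathrm{Tor}_i^R(S,S)=0$ for all $i>0$. -/

import Mathlib

open CategoryTheory MulOpposite
open scoped TensorProduct

universe u

noncomputable section

namespace Tilting

/-- The category of right `R`-modules, i.e. of left modules over the opposite ring. -/
abbrev RightMod (R : Type u) [Ring R] := ModuleCat.{u} Rᵐᵒᵖ

section Tensor

variable {R : Type u} [Ring R]

/-- The subgroup of `M ⊗_ℤ N` generated by the elements `m r ⊗ n - m ⊗ r n`. -/
def balancedRel (M : RightMod R) (N : ModuleCat.{u} R) : AddSubgroup (M ⊗[ℤ] N) :=
  AddSubgroup.closure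
    {x | ∃ (m : M) (r : R) (n : N), x = (op r • m) ⊗ₜ[ℤ] n - m ⊗ₜ[ℤ] (r • n)}

/-- The abelian group `M ⊗_R N`, for a right module `M` and a left module `N` over a ring which
need not be commutative. -/
abbrev TensorOver (M : RightMod R) (N : ModuleCat.{u} R) : Type u :=
  (M ⊗[ℤ] N) ⧸ balancedRel M N

/-- The class of `m ⊗ n` in `M ⊗_R N`. -/
def tmulOver {M : RightMod R} {N : ModuleCat.{u} R} (m : M) (n : N) : TensorOver M N :=
  QuotientAddGroup.mk (m ⊗ₜ[ℤ] n)

/-- The map `f ⊗ N : M ⊗_R N → M' ⊗_R N`. -/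
def tensorMap {M M' : RightMod R} (f : M ⟶ M') (N : ModuleCat.{u} R) :
    TensorOver M N →+ TensorOver M' N :=
  QuotientAddGroup.map (balancedRel M N) (balancedRel M' N)
    (TensorProduct.map f.hom.toAddMonoidHom.toIntLinearMap
      (LinearMap.id : N →ₗ[ℤ] N)).toAddMonoidHom (by
      rw [balancedRel, AddSubgroup.closure_le]
      rintro _ ⟨m, r, n, rfl⟩
      refine AddSubgroup.subset_closure ⟨f.hom m, r, n, ?_⟩
      rw [map_sub, ← map_smul]
      rfl)

theorem tensorMap_tmul {M M' : RightMod R} (f : M ⟶ M') (N : ModuleCat.{u} R) (m : M) (n : N) :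
    tensorMap f N (tmulOver m n) = tmulOver (f.hom m) n := rfl

theorem tensorOver_hom_ext {M : RightMod R} {N : ModuleCat.{u} R} {A : Type u} [AddCommGroup A]
    {f g : TensorOver M N →+ A}
    (h : ∀ (m : M) (n : N), f (tmulOver m n) = g (tmulOver m n)) : f = g := by
  refine QuotientAddGroup.addMonoidHom_ext _ (AddMonoidHom.ext fun x => ?_)
  induction x using TensorProduct.induction_on with
  | zero => rw [map_zero, map_zero]
  | tmul m n => exact h m n
  | add x y hx hy => rw [map_add, map_add, hx, hy]

/-- The functor `- ⊗_R N` from right `R`-modules to abelian groups. -/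
def tensorFunctor (N : ModuleCat.{u} R) : RightMod R ⥤ AddCommGrpCat.{u} where
  obj M := AddCommGrpCat.of (TensorOver M N)
  map f := AddCommGrpCat.ofHom (tensorMap f N)
  map_id M := by
    ext1
    exact tensorOver_hom_ext fun m n => rfl
  map_comp f g := by
    ext1
    exact tensorOver_hom_ext fun m n => rfl

instance tensorFunctor_additive (N : ModuleCat.{u} R) : (tensorFunctor N).Additive where
  map_add {M M' f g} := by
    ext1
    refine tensorOver_hom_ext fun m n => ?_
    change QuotientAddGroup.mk ((f.hom m + g.hom m) ⊗ₜ[ℤ] n) = _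
    rw [TensorProduct.add_tmul]
    rfl

/-- `Tor_n^R(M, N)`, the `n`-th left derived functor of `- ⊗_R N` at `M`. -/
def Tor (n : ℕ) (M : RightMod R) (N : ModuleCat.{u} R) : AddCommGrpCat.{u} :=
  ((tensorFunctor N).leftDerived n).obj M

end Tensor

section Epi

variable {R S : Type u} [Ring R] [Ring S]

/-- `S` as a right `R`-module via `l : R → S`. -/
abbrev rightOf (l : R →+* S) : RightMod R :=
  (ModuleCat.restrictScalars (RingHom.op l)).obj (ModuleCat.of Sᵐᵒᵖ S)

/-- `S` as a left `R`-module via `l : R → S`. -/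
abbrev leftOf (l : R →+* S) : ModuleCat.{u} R :=
  (ModuleCat.restrictScalars l).obj (ModuleCat.of S S)

/-- The ring homomorphism `l : R → S`, as a map of right `R`-modules. -/
def unitMap (l : R →+* S) : R →ₗ[Rᵐᵒᵖ] rightOf l where
  toFun r := (l r : S)
  map_add' x y := map_add l x y
  map_smul' x y := map_mul l y x.unop

/-- The right `R`-module `S/R`, the cokernel of `l : R → S`. -/
abbrev cokerOf (l : R →+* S) : RightMod R :=
  ModuleCat.of Rᵐᵒᵖ (rightOf l ⧸ LinearMap.range (unitMap l))

/-- The right `R`-module `S ⊕ S/R`. -/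
abbrev sumOf (l : R →+* S) : RightMod R :=
  ModuleCat.of Rᵐᵒᵖ (rightOf l × cokerOf l)

/-- `l` is an epimorphism in the category of rings. -/
def IsRingEpi (l : R →+* S) : Prop := Epi (RingCat.ofHom l)

/-- `l` is a ring epimorphism with `Tor_i^R(S, S) = 0` for all `i > 0`. -/
def IsHomologicalRingEpi (l : R →+* S) : Prop :=
  IsRingEpi l ∧ ∀ i : ℕ, 0 < i → Limits.IsZero (Tor i (rightOf l) (leftOf l))

end Epi

section Modules

variable {R : Type u} [Ring R]

/-- `L^⊥`: the modules `M` with `Ext^1_R(L, M) = 0`. -/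
def perp (L : RightMod R) : ObjectProperty (RightMod R) :=
  fun M => Subsingleton (Abelian.Ext L M 1)

/-- `Gen M`: the epimorphic images of direct sums of copies of `M`. -/
def Gen (M : RightMod R) : ObjectProperty (RightMod R) :=
  fun X => ∃ (I : Type u) (f : (I →₀ M) →ₗ[Rᵐᵒᵖ] X), Function.Surjective f

/-- `Add M`: the modules isomorphic to a direct summand of a direct sum of copies of `M`. -/
def Add (M : RightMod R) : ObjectProperty (RightMod R) :=
  fun X => ∃ (I : Type u) (Y : RightMod R), Nonempty ((X × Y) ≃ₗ[Rᵐᵒᵖ] (I →₀ M))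

/-- `T` is a tilting module: `Gen T = T^⊥`. -/
def IsTilting (T : RightMod R) : Prop := Gen T = perp T

/-- Equivalence of tilting modules: they have the same tilting class. -/
def TiltingEquiv (T T' : RightMod R) : Prop := perp T = perp T'

/-- `f : M → X` is a `C`-preenvelope of `M`. -/
def IsPreenvelope (C : ObjectProperty (RightMod R)) {M X : RightMod R} (f : M ⟶ X) : Prop :=
  C X ∧ ∀ (X' : RightMod R), C X' → ∀ f' : M ⟶ X', ∃ g : X ⟶ X', f ≫ g = f'

/-- `f : M → X` is a `C`-envelope of `M`: a left minimal `C`-preenvelope. -/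
def IsEnvelope (C : ObjectProperty (RightMod R)) {M X : RightMod R} (f : M ⟶ X) : Prop :=
  IsPreenvelope C f ∧ ∀ g : X ⟶ X, f ≫ g = f → IsIso g

/-- `l : R → S` is an injective ring epimorphism with `Tor_1^R(S, S) = 0` such that `S ⊕ S/R` is a
tilting module equivalent to `T`. -/
def ArisesFrom (T : RightMod R) {S : Type u} [Ring S] (l : R →+* S) : Prop :=
  Function.Injective l ∧ IsRingEpi l ∧ Limits.IsZero (Tor 1 (rightOf l) (leftOf l)) ∧
    IsTilting (sumOf l) ∧ TiltingEquiv (sumOf l) T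

/-- `0 → R → T₀ → T₁ → 0` (with maps `a` and `p`) is a short exact sequence of right `R`-modules
with `T₀, T₁ ∈ Add T` and `Hom_R(T₁, T₀) = 0`. -/
def IsSpecialSequence (T : RightMod R) {T₀ T₁ : RightMod R}
    (a : ModuleCat.of Rᵐᵒᵖ R ⟶ T₀) (p : T₀ ⟶ T₁) : Prop :=
  (∃ w : a ≫ p = 0, (ShortComplex.mk a p w).ShortExact) ∧ Add T T₀ ∧ Add T T₁ ∧
    ∀ f : T₁ ⟶ T₀, f = 0

end Modules

end Tilting

end

/-! Both directions rest on the sequence `0 → R → S → S/R → 0`. Given `l`, equivalent tilting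
modules have the same `Add`, so `S` and `S/R` lie in `Add T`. An `R`-linear map between `S`-modules
is `S`-linear when `l` is epi, so a map `S → S/R → S`, killing `1`, is zero.

Conversely, `Hom(T₁, T₀) = 0` and `Ext¹(T₁, T₀) = 0` make evaluation at `t = a(1)` a bijection
`End(T₀) ≅ T₀`. Hence `S = End(T₀)` receives a ring map from `R` whose sequence is the given one.
The inclusions `Gen S ⊆ T^⊥ ⊆ (S ⊕ S/R)^⊥ ⊆ Gen S` then identify the tilting classes. That `l` is
epi follows because every map from `S/R` to a right `S`-module vanishes.

All Tor statements come from Ext through character modules: `Tor₁(S, S) = 0` because the dual of `S`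
lies in `Gen S`, the higher ones because a tilting module has projective dimension at most one. -/

namespace Tilting

open Abelian

/-! ### Lifting and extension against Ext¹, and closure properties of Gen and Add. -/

section Perp

variable {R : Type u} [Ring R]

theorem exists_lift_of_perp {L : RightMod R} {S : ShortComplex (RightMod R)}
    (hS : S.ShortExact) (h : perp L S.X₁) (f : L ⟶ S.X₃) : ∃ g : L ⟶ S.X₂, g ≫ S.g = f := by
  have := h
  unfold perp at this
  obtain ⟨x, hx⟩ := Ext.covariant_sequence_exact₃ L hS (Ext.mk₀ f) (zero_add 1)
    (Subsingleton.elim _ _)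
  obtain ⟨g, rfl⟩ := Ext.mk₀_bijective _ _ |>.2 x
  exact ⟨g, (Ext.mk₀_bijective _ _).1 (by rw [← hx, Ext.mk₀_comp_mk₀])⟩

theorem exists_extension_of_perp {X : RightMod R} {S : ShortComplex (RightMod R)}
    (hS : S.ShortExact) (h : perp S.X₃ X) (f : S.X₁ ⟶ X) : ∃ g : S.X₂ ⟶ X, S.f ≫ g = f := by
  have := h
  unfold perp at this
  obtain ⟨x, hx⟩ := Ext.contravariant_sequence_exact₁ hS X (Ext.mk₀ f) (add_zero 1)
    (Subsingleton.elim _ _)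
  obtain ⟨g, rfl⟩ := Ext.mk₀_bijective _ _ |>.2 x
  exact ⟨g, (Ext.mk₀_bijective _ _).1 (by rw [← hx, Ext.mk₀_comp_mk₀])⟩

/-- The short exact sequence `0 → M → I → I/M → 0` with `I` injective. -/
theorem exists_shortExact_injective (M : RightMod R) :
    ∃ S : ShortComplex (RightMod R), S.ShortExact ∧ S.X₁ = M ∧ Injective S.X₂ := by
  refine ⟨ShortComplex.mk (Injective.ι M) (Limits.cokernel.π _) (Limits.cokernel.condition _),
    { exact := ShortComplex.exact_cokernel _ }, rfl, ?_⟩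
  dsimp
  infer_instance

/-- Embed `M` in an injective `I`: every class in Ext¹ is the connecting image of a map `L → I/M`,
and it dies once that map lifts to `I`. -/
theorem perp_of_exists_lift {L M : RightMod R}
    (h : ∀ S : ShortComplex (RightMod R), S.ShortExact → S.X₁ = M →
      ∀ f : L ⟶ S.X₃, ∃ g : L ⟶ S.X₂, g ≫ S.g = f) : perp L M := by
  obtain ⟨S, hS, rfl, hI⟩ := exists_shortExact_injective M
  refine subsingleton_of_forall_eq 0 fun x => ?_
  obtain ⟨y, rfl⟩ := Ext.covariant_sequence_exact₁ L hS x (Ext.eq_zero_of_injective _)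
    (zero_add 1)
  obtain ⟨f, rfl⟩ := Ext.mk₀_bijective _ _ |>.2 y
  obtain ⟨g, rfl⟩ := h S hS rfl f
  rw [← Ext.mk₀_comp_mk₀, Ext.comp_assoc_of_second_deg_zero, hS.comp_extClass, Ext.comp_zero]

/-- Linear maps from `L` lift along surjections whose kernel is in `L^⊥`. -/
theorem exists_linear_lift_of_perp {L E N : RightMod R} (p : E →ₗ[Rᵐᵒᵖ] N)
    (hp : Function.Surjective p) (h : perp L (ModuleCat.of Rᵐᵒᵖ (LinearMap.ker p)))
    (f : L →ₗ[Rᵐᵒᵖ] N) : ∃ g : L →ₗ[Rᵐᵒᵖ] E, p ∘ₗ g = f := by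
  obtain ⟨g, hg⟩ := exists_lift_of_perp (S := p.shortComplexKer)
    (p.shortExact_shortComplexKer hp) h (ModuleCat.ofHom f)
  exact ⟨g.hom, congrArg ModuleCat.Hom.hom hg⟩

/-- By the lifting criterion it suffices to lift on each copy of `T` separately, after extending the
map by zero on the complement of `X`. -/
theorem perp_of_add {T X M : RightMod R} (hX : Add T X) (hM : perp T M) : perp X M := by
  obtain ⟨I, Y, ⟨e⟩⟩ := hX
  refine perp_of_exists_lift fun S hS hS₁ f => ?_
  subst hS₁
  let F : (I →₀ T) →ₗ[Rᵐᵒᵖ] S.X₃ := f.hom ∘ₗ LinearMap.fst Rᵐᵒᵖ X Y ∘ₗ e.symm.toLinearMap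
  choose g hg using fun i : I =>
    exists_lift_of_perp hS hM (ModuleCat.ofHom (F ∘ₗ Finsupp.lsingle i))
  have hF : S.g.hom ∘ₗ Finsupp.lsum ℕ (fun i => (g i).hom) = F := by
    refine Finsupp.lhom_ext' fun i => ?_
    have := congrArg ModuleCat.Hom.hom (hg i)
    rw [ModuleCat.hom_ofHom] at this
    rw [← this]
    ext x
    simp
  refine ⟨ModuleCat.ofHom (Finsupp.lsum ℕ (fun i => (g i).hom) ∘ₗ e.toLinearMap ∘ₗ
    LinearMap.inl Rᵐᵒᵖ X Y), ?_⟩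
  ext x
  have := LinearMap.congr_fun hF (e (x, 0))
  simpa [F] using this

theorem gen_of_add {T X : RightMod R} (hX : Add T X) : Gen T X := by
  obtain ⟨I, Y, ⟨e⟩⟩ := hX
  exact ⟨I, LinearMap.fst Rᵐᵒᵖ X Y ∘ₗ e.symm.toLinearMap,
    (LinearMap.fst_surjective (R := Rᵐᵒᵖ) (M := X) (M₂ := Y)).comp e.symm.surjective⟩

theorem add_congr {T X X' : RightMod R} (e : X ≃ₗ[Rᵐᵒᵖ] X') (hX : Add T X) : Add T X' := by
  obtain ⟨I, Y, ⟨e'⟩⟩ := hX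
  exact ⟨I, Y, ⟨(e.symm.prodCongr (LinearEquiv.refl _ _)).trans e'⟩⟩

theorem gen_of_surjective {T X X' : RightMod R} (p : X →ₗ[Rᵐᵒᵖ] X')
    (hp : Function.Surjective p) (hX : Gen T X) : Gen T X' := by
  obtain ⟨I, f, hf⟩ := hX
  exact ⟨I, p ∘ₗ f, hp.comp hf⟩

theorem gen_finsupp {T X : RightMod R} (hX : Gen T X) (J : Type u) :
    Gen T (ModuleCat.of Rᵐᵒᵖ (J →₀ X)) := by
  obtain ⟨I, f, hf⟩ := hX
  exact ⟨J × I, Finsupp.mapRange.linearMap f ∘ₗ (Finsupp.curryLinearEquiv Rᵐᵒᵖ).toLinearMap,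
    (Finsupp.mapRange_surjective _ (map_zero f) hf).comp (LinearEquiv.surjective _)⟩

theorem gen_trans {T X Y : RightMod R} (hX : Gen T X) (hY : Gen X Y) : Gen T Y := by
  obtain ⟨J, f, hf⟩ := hY
  exact gen_of_surjective (X := ModuleCat.of Rᵐᵒᵖ (J →₀ X)) f hf (gen_finsupp hX J)

theorem add_prod {T X Y : RightMod R} (hX : Add T X) (hY : Add T Y) :
    Add T (ModuleCat.of Rᵐᵒᵖ (X × Y)) := by
  obtain ⟨I, X', ⟨e⟩⟩ := hX
  obtain ⟨J, Y', ⟨e'⟩⟩ := hY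
  exact ⟨I ⊕ J, ModuleCat.of Rᵐᵒᵖ (X' × Y'),
    ⟨(LinearEquiv.prodProdProdComm Rᵐᵒᵖ X Y X' Y').trans
      ((e.prodCongr e').trans (Finsupp.sumFinsuppLEquivProdFinsupp Rᵐᵒᵖ).symm)⟩⟩

theorem add_fst {T X Y : RightMod R} (h : Add T (ModuleCat.of Rᵐᵒᵖ (X × Y))) : Add T X := by
  obtain ⟨I, Z, ⟨e⟩⟩ := h
  exact ⟨I, ModuleCat.of Rᵐᵒᵖ (Y × Z), ⟨(LinearEquiv.prodAssoc Rᵐᵒᵖ X Y Z).symm.trans e⟩⟩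

theorem add_snd {T X Y : RightMod R} (h : Add T (ModuleCat.of Rᵐᵒᵖ (X × Y))) : Add T Y :=
  add_fst (X := Y) (Y := X)
    (add_congr (X' := ModuleCat.of Rᵐᵒᵖ (Y × X)) (LinearEquiv.prodComm Rᵐᵒᵖ X Y) h)

theorem add_self (T : RightMod R) : Add T T :=
  ⟨PUnit, ModuleCat.of Rᵐᵒᵖ PUnit,
    ⟨LinearEquiv.prodUnique.trans (Finsupp.uniqueLinearEquiv Rᵐᵒᵖ T PUnit.unit).symm⟩⟩

/-- Modules in `Add T` lie in the tilting class of `T`. -/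
theorem IsTilting.perp_of_add {T X : RightMod R} (hT : IsTilting T) (hX : Add T X) :
    perp T X := by
  rw [← hT]
  exact gen_of_add hX

/-- Equivalent tilting modules have the same additive closure. -/
theorem add_of_tiltingEquiv {T T' : RightMod R} (hT : IsTilting T) (hT' : IsTilting T')
    (h : TiltingEquiv T' T) : Add T T' := by
  have hgen : Gen T T' := by
    rw [hT, ← h]
    exact hT'.perp_of_add (add_self T')
  -- Indexing by all of `Hom(T, T')` makes every map `T → T'` lift along `p`. The connecting map
  -- therefore vanishes and `Ext¹(T, ker p) = 0`.
  let I := T →ₗ[Rᵐᵒᵖ] T'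
  let p : (I →₀ T) →ₗ[Rᵐᵒᵖ] T' := Finsupp.lsum ℕ id
  have hp : Function.Surjective p := by
    obtain ⟨J, f, hf⟩ := hgen
    intro y
    obtain ⟨x, rfl⟩ := hf y
    induction x using Finsupp.induction_linear with
    | zero => exact ⟨0, by simp⟩
    | add a b ha hb =>
      obtain ⟨x, hx⟩ := ha
      obtain ⟨y, hy⟩ := hb
      exact ⟨x + y, by rw [map_add, map_add, hx, hy]⟩
    | single j t => exact ⟨Finsupp.single (f ∘ₗ Finsupp.lsingle j) t, by simp [p]⟩
  have hK : perp T (ModuleCat.of Rᵐᵒᵖ (LinearMap.ker p)) := by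
    refine subsingleton_of_forall_eq 0 fun x => ?_
    have hS := p.shortExact_shortComplexKer hp
    have : Subsingleton (Ext T (ModuleCat.of Rᵐᵒᵖ (I →₀ T)) 1) := by
      change perp T _
      rw [← hT]
      exact ⟨I, LinearMap.id, Function.surjective_id⟩
    obtain ⟨y, rfl⟩ := Ext.covariant_sequence_exact₁ T hS x (this.elim _ _) (zero_add 1)
    obtain ⟨f, rfl⟩ := Ext.mk₀_bijective _ _ |>.2 y
    let g : T ⟶ ModuleCat.of Rᵐᵒᵖ (I →₀ T) := ModuleCat.ofHom (Finsupp.lsingle f.hom)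
    have hg : g ≫ p.shortComplexKer.g = f := by
      ext t
      simp [g, p]
    rw [← hg, ← Ext.mk₀_comp_mk₀, Ext.comp_assoc_of_second_deg_zero, hS.comp_extClass,
      Ext.comp_zero]
  -- Equivalence turns this into `Ext¹(T', ker p) = 0`, so `p` splits and `T'` is a summand of a sum
  -- of copies of `T`.
  rw [← h] at hK
  obtain ⟨s, hs⟩ := exists_linear_lift_of_perp (L := T')
    (E := ModuleCat.of Rᵐᵒᵖ (I →₀ T)) (N := T') p hp hK LinearMap.id
  replace hs (x : T') : p (s x) = x := LinearMap.congr_fun hs x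
  refine ⟨I, ModuleCat.of Rᵐᵒᵖ (LinearMap.ker p),
    ⟨LinearEquiv.ofBijective (s.coprod (LinearMap.ker p).subtype) ⟨?_, fun y => ?_⟩⟩⟩
  · rw [injective_iff_map_eq_zero]
    rintro ⟨x, y, hy⟩ hxy
    replace hxy : s x + y = 0 := hxy
    have hx : x = 0 := by
      have := congrArg p hxy
      rwa [map_add, hs, LinearMap.mem_ker.1 hy, add_zero, map_zero] at this
    subst hx
    rw [map_zero, zero_add] at hxy
    subst hxy
    rfl
  · refine ⟨(p y, ⟨y - s (p y), ?_⟩), ?_⟩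
    · rw [LinearMap.mem_ker, map_sub, hs, sub_self]
    · exact add_sub_cancel (s (p y)) y

end Perp

/-! ### Projective dimension at most one of tilting modules. -/

section Dimension

variable {R : Type u} [Ring R]

/-- Injectives lie in `T^⊥ = Gen T`, which is closed under quotients. So every first cosyzygy lies
in `T^⊥`, and dimension shifting does the rest. -/
theorem subsingleton_ext_of_tilting {T : RightMod R} (hT : IsTilting T) (n : ℕ)
    (M : RightMod R) : Subsingleton (Ext T M (n + 2)) := by
  induction n generalizing M with
  | zero =>
    obtain ⟨S, hS, rfl, hI⟩ := exists_shortExact_injective M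
    have hI' : perp T S.X₂ := Ext.subsingleton_of_injective _ _ 0
    have h : perp T S.X₃ := by
      rw [← hT] at hI' ⊢
      exact gen_of_surjective S.g.hom ((ModuleCat.epi_iff_surjective _).1 hS.epi_g) hI'
    refine subsingleton_of_forall_eq 0 fun x => ?_
    obtain ⟨y, rfl⟩ := Ext.covariant_sequence_exact₁ T hS x (Ext.eq_zero_of_injective _) rfl
    rw [h.elim y 0, Ext.zero_comp]
  | succ n ih =>
    obtain ⟨S, hS, rfl, hI⟩ := exists_shortExact_injective M
    refine subsingleton_of_forall_eq 0 fun x => ?_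
    obtain ⟨y, rfl⟩ := Ext.covariant_sequence_exact₁ T hS x (Ext.eq_zero_of_injective _) rfl
    rw [(ih S.X₃).elim y 0, Ext.zero_comp]

theorem subsingleton_ext_of_retract {X T : RightMod R} (r : Retract X T) {n : ℕ} {M : RightMod R}
    (h : Subsingleton (Ext T M n)) : Subsingleton (Ext X M n) := by
  refine subsingleton_of_forall_eq 0 fun x => ?_
  rw [← Ext.mk₀_id_comp x, ← r.retract, ← Ext.mk₀_comp_mk₀_assoc,
    h.elim ((Ext.mk₀ r.r).comp x (zero_add n)) 0, Ext.comp_zero]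

end Dimension

/-! ### Tensor–Hom duality with character modules, and Tor from Ext. -/

section CharacterDual

variable {R : Type u} [Ring R]

/-- The character group of a left `R`-module is a right `R`-module. -/
instance characterModuleOp (N : ModuleCat.{u} R) : Module Rᵐᵒᵖ (CharacterModule N) where
  smul r c := AddMonoidHom.comp c (DistribSMul.toAddMonoidHom N r.unop)
  one_smul c := by
    ext x
    exact congrArg c (one_smul R x)
  mul_smul r s c := by
    ext x
    exact congrArg c (mul_smul s.unop r.unop x)
  smul_zero r := rfl
  smul_add r c d := rfl
  add_smul r s c := by
    ext x
    exact (congrArg c (add_smul r.unop s.unop x)).trans (map_add c _ _)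
  zero_smul c := by
    ext x
    exact (congrArg c (zero_smul R x)).trans (map_zero c)

/-- The right `R`-module `Hom_ℤ(N, ℚ/ℤ)`. -/
abbrev rightDual (N : ModuleCat.{u} R) : RightMod R := ModuleCat.of Rᵐᵒᵖ (CharacterModule N)

/-- Characters of `M ⊗_R N` as homomorphisms from `M` to the dual of `N`. -/
def tensorCurry {M : RightMod R} {N : ModuleCat.{u} R} (c : CharacterModule (TensorOver M N)) :
    M ⟶ rightDual N :=
  ModuleCat.ofHom
    { toFun := fun m =>
        AddMonoidHom.mk' (fun n => c (tmulOver m n)) fun x y => by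
          rw [← map_add]
          refine congrArg c ?_
          rw [tmulOver, TensorProduct.tmul_add]
          rfl
      map_add' := fun x y => by
        ext n
        refine Eq.trans (congrArg c ?_) (map_add c _ _)
        rw [tmulOver, TensorProduct.add_tmul]
        rfl
      map_smul' := fun r m => by
        ext n
        refine congrArg c ((QuotientAddGroup.eq_iff_sub_mem).2 ?_)
        exact AddSubgroup.subset_closure ⟨m, r.unop, n, rfl⟩ }

theorem exists_tensorCurry_eq {M : RightMod R} {N : ModuleCat.{u} R} (g : M ⟶ rightDual N) :
    ∃ c : CharacterModule (TensorOver M N), tensorCurry c = g := by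
  let B : M →ₗ[ℤ] N →ₗ[ℤ] AddCircle (1 : ℚ) :=
    AddMonoidHom.toIntLinearMap
      { toFun := fun m => AddMonoidHom.toIntLinearMap (g.hom m : N →+ AddCircle (1 : ℚ))
        map_zero' := by
          rw [map_zero]
          rfl
        map_add' := fun x y => by
          rw [map_add]
          rfl }
  refine ⟨QuotientAddGroup.lift _ (TensorProduct.lift B).toAddMonoidHom ?_, rfl⟩
  rw [balancedRel, AddSubgroup.closure_le]
  rintro _ ⟨m, r, n, rfl⟩
  rw [SetLike.mem_coe, AddMonoidHom.mem_ker, map_sub, sub_eq_zero]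
  exact DFunLike.congr_fun (show (g.hom (op r • m) : CharacterModule N) =
    op r • (g.hom m : CharacterModule N) from map_smul g.hom _ _) n

theorem tensorCurry_injective {M : RightMod R} {N : ModuleCat.{u} R} :
    Function.Injective (tensorCurry (M := M) (N := N)) := by
  intro c d h
  refine QuotientAddGroup.addMonoidHom_ext _ (AddMonoidHom.ext fun x => ?_)
  induction x using TensorProduct.induction_on with
  | zero => rw [map_zero, map_zero]
  | tmul m n =>
    exact DFunLike.congr_fun (show (tensorCurry c).hom m = (tensorCurry d).hom m by rw [h]) n
  | add x y hx hy => rw [map_add, map_add, hx, hy]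

theorem exists_character_of_notMem {A : Type u} [AddCommGroup A] (B : AddSubgroup A) {x : A}
    (hx : x ∉ B) : ∃ c : CharacterModule A, (∀ b ∈ B, c b = 0) ∧ c x ≠ 0 := by
  obtain ⟨c, hc⟩ := CharacterModule.exists_character_apply_ne_zero_of_ne_zero
    (a := (QuotientAddGroup.mk x : A ⧸ B)) (by rwa [Ne, QuotientAddGroup.eq_zero_iff])
  refine ⟨AddMonoidHom.comp c (QuotientAddGroup.mk' B), fun b hb => ?_, hc⟩
  exact (congrArg c ((QuotientAddGroup.eq_zero_iff b).2 hb)).trans (map_zero c)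

theorem tensorCurry_comp {M M' : RightMod R} {N : ModuleCat.{u} R} (f : M ⟶ M')
    (c : CharacterModule (TensorOver M' N)) :
    tensorCurry (AddMonoidHom.comp c (tensorMap f N)) = f ≫ tensorCurry c := rfl

/-- If `Ext^{n+1}_R(M, Hom_ℤ(N, ℚ/ℤ)) = 0`, then `Tor_{n+1}^R(M, N) = 0`. -/
theorem isZero_tor_of_subsingleton_ext {M : RightMod R} {N : ModuleCat.{u} R} {n : ℕ}
    (h : Subsingleton (Ext M (rightDual N) (n + 1))) : Limits.IsZero (Tor (n + 1) M N) := by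
  let P := projectiveResolution M
  refine Limits.IsZero.of_iso ?_ (P.isoLeftDerivedObj (tensorFunctor N) (n + 1))
  refine (HomologicalComplex.exactAt_iff_isZero_homology _ _).1 ?_
  rw [HomologicalComplex.exactAt_iff' _ (n + 2) (n + 1) n (by simp) (by simp),
    ShortComplex.ab_exact_iff]
  intro x hx
  replace hx : tensorMap (P.complex.d (n + 1) n) N x = 0 := hx
  change ∃ y, tensorMap (P.complex.d (n + 2) (n + 1)) N y = x
  by_contra hxr
  -- A cycle `x` that is not a boundary is detected by a character `c` killing boundaries. Such a
  -- `c` is a cocycle with values in the dual of `N`. Vanishing Ext makes it a coboundary, which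
  -- kills the cycle `x`: a contradiction.
  obtain ⟨c, hc, hcx⟩ := exists_character_of_notMem
    (tensorMap (P.complex.d (n + 2) (n + 1)) N).range (x := x) hxr
  have hcoc : P.complex.d (n + 2) (n + 1) ≫ tensorCurry c = 0 := by
    ext m : 2
    refine DFunLike.ext (F := CharacterModule N) _ _ fun k => ?_
    exact hc _ ⟨tmulOver m k, rfl⟩
  obtain ⟨g, hg⟩ := (P.extMk_eq_zero_iff (tensorCurry c) (n + 2) rfl hcoc n rfl).1
    (Subsingleton.elim _ _)
  obtain ⟨d, rfl⟩ := exists_tensorCurry_eq g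
  rw [← tensorCurry_comp] at hg
  have hcd : AddMonoidHom.comp d (tensorMap (P.complex.d (n + 1) n) N) = c :=
    tensorCurry_injective hg
  refine hcx ?_
  rw [← hcd]
  exact (congrArg d hx).trans (map_zero d)

end CharacterDual

/-! ### Ring epimorphisms and maps out of `S/R`. -/

section RingEpi

variable {R S : Type u} [Ring R] [Ring S]

/-- The identity of `S`, as a map into the right `R`-module `S`. -/
def toRightOf (l : R →+* S) : S ≃+ rightOf l := AddEquiv.refl S

theorem op_smul_toRightOf (l : R →+* S) (r : R) (s : S) :
    op r • toRightOf l s = toRightOf l (s * l r) := rfl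

theorem unitMap_apply (l : R →+* S) (r : R) : unitMap l r = toRightOf l (l r) := rfl

/-- An additive map between right modules over the codomain of a ring epimorphism is linear as soon
as it is linear over the domain. -/
theorem IsRingEpi.map_mul {l : R →+* S} (hl : IsRingEpi l) (g : S →+ S)
    (hg : ∀ x r, g (x * l r) = g x * l r) (x s : S) : g (x * s) = g x * s := by
  -- `φ` is the diagonal right action on `S × S` and `ψ` its conjugate by `(x, y) ↦ (x, y + g x)`.
  -- They agree on the image of `l` because `g` is `R`-linear, hence everywhere since `l` is epi.
  -- The opposite ring accounts for right actions.
  let φ (s : S) : S × S →+ S × S :=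
    AddMonoidHom.mk' (fun z => (z.1 * s, z.2 * s)) fun z w => by simp [add_mul]
  let ψ (s : S) : S × S →+ S × S :=
    AddMonoidHom.mk' (fun z => (z.1 * s, z.2 * s + g (z.1 * s) - g z.1 * s)) fun z w => by
      ext
      · simp [add_mul]
      · simp only [Prod.fst_add, Prod.snd_add, add_mul, map_add]
        abel
  have hφ (s : S) (z : S × S) : φ s z = (z.1 * s, z.2 * s) := rfl
  have hψ (s : S) (z : S × S) : ψ s z = (z.1 * s, z.2 * s + g (z.1 * s) - g z.1 * s) := rfl
  let Φ : S →+* (AddMonoid.End (S × S))ᵐᵒᵖ :=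
    { toFun := fun s => op (φ s)
      map_one' := unop_injective (AddMonoidHom.ext fun z => show φ 1 z = z by simp [hφ])
      map_mul' := fun s t => unop_injective (AddMonoidHom.ext fun z =>
        show φ (s * t) z = φ t (φ s z) by simp [hφ, mul_assoc])
      map_zero' := unop_injective (AddMonoidHom.ext fun z => show φ 0 z = 0 by simp [hφ])
      map_add' := fun s t => unop_injective (AddMonoidHom.ext fun z =>
        show φ (s + t) z = φ s z + φ t z by simp [hφ, mul_add]) }
  let Ψ : S →+* (AddMonoid.End (S × S))ᵐᵒᵖ :=
    { toFun := fun s => op (ψ s)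
      map_one' := unop_injective (AddMonoidHom.ext fun z => show ψ 1 z = z by simp [hψ])
      map_mul' := fun s t => unop_injective (AddMonoidHom.ext fun z =>
        show ψ (s * t) z = ψ t (ψ s z) by
          simp only [hψ, mul_assoc, add_mul, sub_mul]
          congr 1
          abel)
      map_zero' := unop_injective (AddMonoidHom.ext fun z => show ψ 0 z = 0 by simp [hψ])
      map_add' := fun s t => unop_injective (AddMonoidHom.ext fun z =>
        show ψ (s + t) z = ψ s z + ψ t z by
          rw [hψ, hψ, hψ, Prod.mk_add_mk, mul_add, mul_add, mul_add, map_add]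
          congr 1
          abel) }
  have : RingCat.ofHom Φ = RingCat.ofHom Ψ := by
    have : Epi (RingCat.ofHom l) := hl
    rw [← cancel_epi (RingCat.ofHom l)]
    ext r : 2
    refine unop_injective (AddMonoidHom.ext fun z => ?_)
    change φ (l r) z = ψ (l r) z
    rw [hφ, hψ, hg, add_sub_cancel_right]
  have h : φ s (x, 0) = ψ s (x, 0) :=
    congrArg (fun F : S →+* (AddMonoid.End (S × S))ᵐᵒᵖ => (F s).unop (x, 0))
      (congrArg RingCat.Hom.hom this)
  rw [hφ, hψ, Prod.mk.injEq, zero_mul, zero_add] at h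
  exact sub_eq_zero.1 h.2.symm

/-- The composite `S → S/R → S` is `S`-linear, hence determined by its value at `1`, which is zero.
-/
theorem IsRingEpi.cokerOf_hom_eq_zero {l : R →+* S} (hl : IsRingEpi l)
    (f : cokerOf l ⟶ rightOf l) : f = 0 := by
  let q := (LinearMap.range (unitMap l)).mkQ
  have hq : q (toRightOf l 1) = 0 := by
    refine (Submodule.Quotient.mk_eq_zero _).2 ⟨1, ?_⟩
    rw [unitMap_apply, map_one]
  let g : S →+ S := (toRightOf l).symm.toAddMonoidHom.comp
    ((f.hom ∘ₗ q).toAddMonoidHom.comp (toRightOf l).toAddMonoidHom)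
  have hg (s : S) : toRightOf l (g s) = f.hom (q (toRightOf l s)) := rfl
  have hg1 : g 1 = 0 := (toRightOf l).injective (by rw [hg, hq, map_zero, map_zero])
  have hg0 (s : S) : g s = 0 := by
    have := hl.map_mul g (fun x r => (toRightOf l).injective (by
      rw [hg, ← op_smul_toRightOf, ← op_smul_toRightOf, map_smul, map_smul, hg])) 1 s
    rwa [one_mul, hg1, zero_mul] at this
  ext y
  obtain ⟨s, rfl⟩ := (toRightOf l).surjective y
  exact (hg s).symm.trans (by rw [hg0, map_zero]; rfl)

/-- The `R`-linear map `S → M`, `s ↦ m s`, for an element `m` of a right `S`-module `M`. -/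
noncomputable def orbitMap (l : R →+* S) {M : ModuleCat.{u} Sᵐᵒᵖ} (m : M) :
    rightOf l →ₗ[Rᵐᵒᵖ] (ModuleCat.restrictScalars (RingHom.op l)).obj M where
  toFun s := (op ((toRightOf l).symm s) • m : M)
  map_add' s t := add_smul (op ((toRightOf l).symm s)) (op ((toRightOf l).symm t)) m
  map_smul' r s := mul_smul (op (l r.unop)) (op ((toRightOf l).symm s)) m

theorem orbitMap_one (l : R →+* S) {M : ModuleCat.{u} Sᵐᵒᵖ} (m : M) :
    orbitMap l m (toRightOf l 1) = m := one_smul Sᵐᵒᵖ m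

/-- Restrictions of right `S`-modules are generated by `S`. -/
theorem gen_restrictScalars (l : R →+* S) (M : ModuleCat.{u} Sᵐᵒᵖ) :
    Gen (rightOf l) ((ModuleCat.restrictScalars (RingHom.op l)).obj M) :=
  ⟨M, Finsupp.lsum ℕ fun m : M => orbitMap l m, fun m =>
    ⟨Finsupp.single m (toRightOf l 1), (Finsupp.lsum_single _ _ _ _).trans (orbitMap_one l m)⟩⟩

theorem linearMap_finsupp_eq_zero {X Y : RightMod R} (h : ∀ f : X ⟶ Y, f = 0) {I : Type u}
    (g : X →ₗ[Rᵐᵒᵖ] I →₀ Y) : g = 0 := by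
  refine LinearMap.ext fun x => Finsupp.ext fun i => ?_
  have := congrArg ModuleCat.Hom.hom (h (ModuleCat.ofHom (Finsupp.lapply i ∘ₗ g)))
  exact LinearMap.congr_fun this x

/-- If `Hom_R(S/R, S) = 0` and `Ext^1_R(S/R, M) = 0` for all `M` generated by `S`, then
`Hom_R(S/R, M) = 0` for every right `S`-module `M`. -/
theorem cokerOf_hom_restrictScalars_eq_zero {l : R →+* S}
    (h0 : ∀ f : cokerOf l ⟶ rightOf l, f = 0)
    (h1 : ∀ M, Gen (rightOf l) M → perp (cokerOf l) M) (M : ModuleCat.{u} Sᵐᵒᵖ)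
    (f : cokerOf l →ₗ[Rᵐᵒᵖ] (ModuleCat.restrictScalars (RingHom.op l)).obj M) : f = 0 := by
  -- Cover `M` by a free `S`-module, `S`-linearly, so that the kernel is an `S`-module and thus
  -- generated by `S`. Then `f` lifts to a sum of copies of `S`, where it vanishes componentwise.
  let π : (M →₀ S) →ₗ[Sᵐᵒᵖ] M := Finsupp.lsum ℕ fun m =>
    { toFun := fun s : S => (op s • m : M)
      map_add' := fun s t => add_smul (op s) (op t) m
      map_smul' := fun r s => mul_smul r (op s) m }
  have hπ : Function.Surjective π := fun m => by
    refine ⟨Finsupp.single m 1, ?_⟩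
    rw [Finsupp.lsum_single]
    exact one_smul Sᵐᵒᵖ m
  let p : (ModuleCat.of Rᵐᵒᵖ (M →₀ rightOf l)) →ₗ[Rᵐᵒᵖ] (ModuleCat.restrictScalars (RingHom.op l)).obj M :=
    { toFun := fun x => π x
      map_add' := fun x y => map_add π x y
      map_smul' := fun r x => map_smul π (op (l r.unop)) x }
  let κ : (ModuleCat.restrictScalars (RingHom.op l)).obj
      (ModuleCat.of Sᵐᵒᵖ (LinearMap.ker π)) →ₗ[Rᵐᵒᵖ] LinearMap.ker p :=
    { toFun := fun x => ⟨x.1, x.2⟩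
      map_add' := fun x y => rfl
      map_smul' := fun r x => rfl }
  have hK : perp (cokerOf l) (ModuleCat.of Rᵐᵒᵖ (LinearMap.ker p)) :=
    h1 _ (gen_of_surjective (X' := ModuleCat.of Rᵐᵒᵖ (LinearMap.ker p)) κ
      (fun x => ⟨⟨x.1, x.2⟩, rfl⟩) (gen_restrictScalars l _))
  obtain ⟨g, rfl⟩ := exists_linear_lift_of_perp (L := cokerOf l)
    (E := ModuleCat.of Rᵐᵒᵖ (M →₀ rightOf l)) p hπ hK f
  rw [linearMap_finsupp_eq_zero h0 g, LinearMap.comp_zero]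

/-- If `f` and `g` agree on `R`, then `f - g` is `R`-linear into the codomain, viewed as an
`S`-module through `f`. It kills `R`, so it factors through `S/R` and is zero. -/
theorem isRingEpi_of_cokerOf {l : R →+* S}
    (h0 : ∀ f : cokerOf l ⟶ rightOf l, f = 0)
    (h1 : ∀ M, Gen (rightOf l) M → perp (cokerOf l) M) : IsRingEpi l := by
  refine ⟨fun {A} f g hfg => ?_⟩
  have hfg' (r : R) : f.hom (l r) = g.hom (l r) :=
    RingHom.congr_fun (congrArg RingCat.Hom.hom hfg) r
  let M : ModuleCat.{u} Sᵐᵒᵖ :=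
    (ModuleCat.restrictScalars (RingHom.op f.hom)).obj (ModuleCat.of Aᵐᵒᵖ A)
  let d : rightOf l →ₗ[Rᵐᵒᵖ] (ModuleCat.restrictScalars (RingHom.op l)).obj M :=
    { toFun := fun s => (f.hom - g.hom : S →+ A) ((toRightOf l).symm s)
      map_add' := fun s t => map_add ((f.hom : S →+ A) - (g.hom : S →+ A)) _ _
      map_smul' := fun r s => by
        obtain ⟨s, rfl⟩ := (toRightOf l).surjective s
        change f.hom (s * l r.unop) - g.hom (s * l r.unop) = (f.hom s - g.hom s) * f.hom (l r.unop)
        rw [map_mul, map_mul, ← hfg', sub_mul] }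
  have hd : LinearMap.range (unitMap l) ≤ LinearMap.ker d := by
    rintro _ ⟨r, rfl⟩
    exact sub_eq_zero.2 (hfg' r)
  have h := cokerOf_hom_restrictScalars_eq_zero h0 h1 M (Submodule.liftQ _ d hd)
  ext s
  refine sub_eq_zero.1 ?_
  exact LinearMap.congr_fun h (Submodule.Quotient.mk s)

end RingEpi

/-! ### The two implications, the envelope and the homological property. -/

section Main

variable {R : Type u} [Ring R] {T : RightMod R}

theorem isHomologicalRingEpi_of_arisesFrom {S : Type u} [Ring S] {l : R →+* S}
    (h : ArisesFrom T l) : IsHomologicalRingEpi l := by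
  obtain ⟨-, hepi, htor, htilt, -⟩ := h
  refine ⟨hepi, fun i hi => ?_⟩
  obtain ⟨n, rfl⟩ := Nat.exists_eq_succ_of_ne_zero hi.ne'
  cases n with
  | zero => exact htor
  | succ n =>
    refine isZero_tor_of_subsingleton_ext (subsingleton_ext_of_retract
      (T := sumOf l) ⟨ModuleCat.ofHom (LinearMap.inl Rᵐᵒᵖ (rightOf l) (cokerOf l)),
        ModuleCat.ofHom (LinearMap.fst Rᵐᵒᵖ (rightOf l) (cokerOf l)), rfl⟩
      (subsingleton_ext_of_tilting htilt n _))

theorem shortExact_mkQ {X Y : RightMod R} (f : X →ₗ[Rᵐᵒᵖ] Y) (hf : Function.Injective f) :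
    ∃ w : ModuleCat.ofHom f ≫ ModuleCat.ofHom (LinearMap.range f).mkQ = 0,
      (ShortComplex.mk (X₁ := X) (X₂ := Y) _ _ w).ShortExact := by
  have w : ModuleCat.ofHom f ≫ ModuleCat.ofHom (LinearMap.range f).mkQ = 0 := by
    ext x
    exact (Submodule.Quotient.mk_eq_zero _).2 ⟨x, rfl⟩
  refine ⟨w, { exact := ?_, mono_f := ?_, epi_g := ?_ }⟩
  · rw [ShortComplex.moduleCat_exact_iff]
    intro x hx
    exact (Submodule.Quotient.mk_eq_zero _).1 hx
  · exact (ModuleCat.mono_iff_injective _).2 hf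
  · exact (ModuleCat.epi_iff_surjective _).2 (Submodule.mkQ_surjective _)

theorem exists_isSpecialSequence_of_arisesFrom (hT : IsTilting T) {S : Type u} [Ring S]
    {l : R →+* S} (h : ArisesFrom T l) :
    ∃ (T₀ T₁ : RightMod R) (a : ModuleCat.of Rᵐᵒᵖ R ⟶ T₀) (p : T₀ ⟶ T₁),
      IsSpecialSequence T a p := by
  obtain ⟨hinj, hepi, -, htilt, hequiv⟩ := h
  have hadd := add_of_tiltingEquiv hT htilt hequiv
  exact ⟨rightOf l, cokerOf l, _, _, shortExact_mkQ (X := ModuleCat.of Rᵐᵒᵖ R)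
    (Y := rightOf l) (unitMap l) hinj, add_fst hadd, add_snd hadd,
    hepi.cokerOf_hom_eq_zero⟩

theorem IsSpecialSequence.isEnvelope (hT : IsTilting T) {T₀ T₁ : RightMod R}
    {a : ModuleCat.of Rᵐᵒᵖ R ⟶ T₀} {p : T₀ ⟶ T₁} (h : IsSpecialSequence T a p) :
    IsEnvelope (perp T) a := by
  obtain ⟨⟨w, hS⟩, h₀, h₁, h⟩ := h
  refine ⟨⟨hT.perp_of_add h₀, fun X hX f =>
    exists_extension_of_perp hS (perp_of_add h₁ hX) f⟩, fun g hg => ?_⟩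
  -- The difference factors through `T₁`, so it is zero: `g` is even the identity.
  have : a ≫ (g - 𝟙 T₀) = 0 := by
    rw [Preadditive.comp_sub, hg, Category.comp_id, sub_self]
  have := hS.epi_g
  obtain ⟨k, hk⟩ : ∃ k : T₁ ⟶ T₀, p ≫ k = g - 𝟙 T₀ := ⟨_, hS.exact.g_desc _ ‹_›⟩
  rw [h k, Limits.comp_zero, eq_comm, sub_eq_zero] at hk
  rw [hk]
  infer_instance

/-- The homomorphism `R → M`, `r ↦ m r`. -/
def elementMap {M : RightMod R} (m : M) : R →ₗ[Rᵐᵒᵖ] M where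
  toFun r := op r • m
  map_add' r s := by rw [MulOpposite.op_add, add_smul]
  map_smul' r s := by
    rw [← op_unop r, op_smul_eq_mul, op_mul, mul_smul]
    rfl

/-- A ring monomorphism with `S` and `S/R` in `Add T` and `Hom_R(S/R, S) = 0` gives rise to `T`. -/
theorem arisesFrom_of_add (hT : IsTilting T) {S : Type u} [Ring S] {l : R →+* S}
    (hl : Function.Injective l) (h₀ : Add T (rightOf l)) (h₁ : Add T (cokerOf l))
    (h : ∀ f : cokerOf l ⟶ rightOf l, f = 0) : ArisesFrom T l := by
  have hgen (M : RightMod R) (hM : Gen (rightOf l) M) : perp T M := by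
    rw [← hT]
    exact gen_trans (gen_of_add h₀) hM
  have hle : ∀ M, perp T M → perp (sumOf l) M := fun M =>
    Tilting.perp_of_add (add_prod h₀ h₁)
  -- Since `Ext¹(S/R, M) = 0`, each map `R → M`, `r ↦ m r`, extends to `S`; together these
  -- extensions cover `M`.
  have hle' : ∀ M, perp (sumOf l) M → Gen (rightOf l) M := by
    intro M hM
    have hM' : perp (cokerOf l) M :=
      Tilting.perp_of_add (add_snd (X := rightOf l) (add_self (sumOf l))) hM
    obtain ⟨w, hS⟩ := shortExact_mkQ (X := ModuleCat.of Rᵐᵒᵖ R) (Y := rightOf l) (unitMap l) hl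
    choose g hg using fun m : M =>
      exists_extension_of_perp hS hM' (ModuleCat.ofHom (elementMap m))
    refine ⟨M, Finsupp.lsum ℕ fun m : M => (g m).hom, fun m =>
      ⟨Finsupp.single m (toRightOf l 1), (Finsupp.lsum_single _ _ _ _).trans ?_⟩⟩
    refine Eq.trans ?_ ((LinearMap.congr_fun (congrArg ModuleCat.Hom.hom (hg m)) (1 : R)).trans
      (one_smul Rᵐᵒᵖ m))
    exact congrArg (g m).hom (map_one l).symm
  have hequiv : perp (sumOf l) = perp T := funext fun M => propext
    ⟨fun hM => hgen M (hle' M hM), hle M⟩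
  refine ⟨hl, isRingEpi_of_cokerOf h fun M hM => Tilting.perp_of_add h₁ (hgen M hM), ?_, ?_,
    hequiv⟩
  -- The character dual of `S` is a right `S`-module, hence lies in `Gen S ⊆ T^⊥`.
  · refine isZero_tor_of_subsingleton_ext (Tilting.perp_of_add h₀ (hgen _ ?_))
    exact gen_restrictScalars l (rightDual (ModuleCat.of S S))
  · refine funext fun M => propext ⟨fun hM => ?_, fun hM => ?_⟩
    · rw [hequiv, ← hT]
      exact gen_trans (gen_of_add (add_prod h₀ h₁)) hM
    · exact gen_trans (gen_of_add (add_fst (add_self (sumOf l)))) (hle' M hM)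

theorem IsSpecialSequence.exists_arisesFrom (hT : IsTilting T) {T₀ T₁ : RightMod R}
    {a : ModuleCat.of Rᵐᵒᵖ R ⟶ T₀} {p : T₀ ⟶ T₁} (h : IsSpecialSequence T a p) :
    ∃ (S : Type u) (_ : Ring S) (l : R →+* S), ArisesFrom T l := by
  obtain ⟨⟨w, hS⟩, h₀, h₁, h⟩ := h
  let t : T₀ := a.hom (1 : R)
  have ha (r : R) : a.hom r = op r • t := by
    rw [← map_smul]
    exact congrArg a.hom (one_mul r).symm
  let ev : Module.End Rᵐᵒᵖ T₀ →+ T₀ := (LinearMap.applyₗ' ℤ t).toAddMonoidHom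
  have hev (f : Module.End Rᵐᵒᵖ T₀) : ev f = f t := rfl
  -- Injective: an endomorphism killing `t` factors through `T₁`, and `Hom(T₁, T₀) = 0`. Surjective:
  -- `r ↦ x r` extends along `a` because `Ext¹(T₁, T₀) = 0`.
  have hbij : Function.Bijective ev := by
    refine ⟨(injective_iff_map_eq_zero ev).2 fun f hf => ?_, fun x => ?_⟩
    · have hf' : a ≫ ModuleCat.ofHom f = 0 := by
        refine ModuleCat.hom_ext (LinearMap.ext fun r => ?_)
        change f (a.hom r) = 0
        rw [ha, map_smul, ← hev, hf, smul_zero]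
      have := hS.epi_g
      have hk := hS.exact.g_desc _ hf'
      rw [h (hS.exact.desc _ hf'), Limits.comp_zero] at hk
      exact (congrArg ModuleCat.Hom.hom hk).symm
    · obtain ⟨g, hg⟩ := exists_extension_of_perp hS (Tilting.perp_of_add h₁ (hT.perp_of_add h₀))
        (ModuleCat.ofHom (elementMap x))
      refine ⟨g.hom, ?_⟩
      exact (LinearMap.congr_fun (congrArg ModuleCat.Hom.hom hg) (1 : R)).trans
        (one_smul Rᵐᵒᵖ x)
  let e : Module.End Rᵐᵒᵖ T₀ ≃+ T₀ := AddEquiv.ofBijective ev hbij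
  have he (f : Module.End Rᵐᵒᵖ T₀) : e f = f t := rfl
  have hsymm (x : T₀) : (e.symm x) t = x := by rw [← he, e.apply_symm_apply]
  -- `l r` is the unique endomorphism sending `t` to `t r`; uniqueness makes `l` a ring
  -- homomorphism.
  let l : R →+* Module.End Rᵐᵒᵖ T₀ :=
    { toFun := fun r => e.symm (op r • t)
      map_one' := e.injective (by rw [he, hsymm, op_one, one_smul]; rfl)
      map_mul' := fun r s => e.injective (by
        rw [he, he, hsymm, Module.End.mul_apply, hsymm, map_smul, hsymm, op_mul, mul_smul])
      map_zero' := by rw [op_zero, zero_smul, map_zero]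
      map_add' := fun r s => by rw [MulOpposite.op_add, add_smul, map_add] }
  have hl (r : R) : l r t = op r • t := hsymm _
  let E : rightOf l ≃ₗ[Rᵐᵒᵖ] T₀ :=
    { (toRightOf l).symm.trans e with
      map_smul' := fun r f => by
        obtain ⟨f, rfl⟩ := (toRightOf l).surjective f
        change (f * l r.unop) t = r • f t
        rw [Module.End.mul_apply, hl, map_smul, op_unop] }
  have hE (r : R) : E (unitMap l r) = a.hom r := (hl r).trans (ha r).symm
  have hexact := (ShortComplex.moduleCat_exact_iff _).1 hS.exact
  have hp : Function.Surjective (p.hom ∘ₗ E.toLinearMap) :=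
    ((ModuleCat.epi_iff_surjective _).1 hS.epi_g).comp E.surjective
  have hker : LinearMap.range (unitMap l) = LinearMap.ker (p.hom ∘ₗ E.toLinearMap) := by
    ext x
    constructor
    · rintro ⟨r, rfl⟩
      change p.hom (E (unitMap l r)) = 0
      rw [hE]
      exact LinearMap.congr_fun (congrArg ModuleCat.Hom.hom w) r
    · intro hx
      obtain ⟨r, hr⟩ := hexact (E x) hx
      exact ⟨r, E.injective ((hE r).trans hr)⟩
  let F : cokerOf l ≃ₗ[Rᵐᵒᵖ] T₁ := (Submodule.quotEquivOfEq _ _ hker).trans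
    (LinearMap.quotKerEquivOfSurjective _ hp)
  refine ⟨_, _, l, arisesFrom_of_add hT (fun r s hrs => ?_) (add_congr E.symm h₀)
    (add_congr F.symm h₁) fun f => ?_⟩
  · refine (ModuleCat.mono_iff_injective _).1 hS.mono_f ?_
    change a.hom r = a.hom s
    rw [ha, ha, ← hl, ← hl, hrs]
  · have := congrArg ModuleCat.Hom.hom
      (h (ModuleCat.ofHom (E.toLinearMap ∘ₗ f.hom ∘ₗ F.symm.toLinearMap)))
    refine ModuleCat.hom_ext (LinearMap.ext fun x => E.injective ?_)
    have := LinearMap.congr_fun this (F x)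
    simpa using this

end Main

end Tilting

theorem mainTheorem2 (R : Type u) [Ring R] (T : Tilting.RightMod R) (hT : Tilting.IsTilting T) :
    ((∃ (S : Type u) (_ : Ring S) (l : R →+* S), Tilting.ArisesFrom T l) ↔
      ∃ (T₀ T₁ : Tilting.RightMod R) (a : ModuleCat.of Rᵐᵒᵖ R ⟶ T₀) (p : T₀ ⟶ T₁),
        Tilting.IsSpecialSequence T a p) ∧
    (∀ (T₀ T₁ : Tilting.RightMod R) (a : ModuleCat.of Rᵐᵒᵖ R ⟶ T₀) (p : T₀ ⟶ T₁),
      Tilting.IsSpecialSequence T a p → Tilting.IsEnvelope (Tilting.perp T) a) ∧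
    (∀ (S : Type u) [Ring S] (l : R →+* S),
      Tilting.ArisesFrom T l → Tilting.IsHomologicalRingEpi l) :=
  ⟨⟨fun ⟨_, _, _, h⟩ => Tilting.exists_isSpecialSequence_of_arisesFrom hT h,
    fun ⟨_, _, _, _, h⟩ => h.exists_arisesFrom hT⟩,
    fun _ _ _ _ h => h.isEnvelope hT,
    fun _ _ _ h => Tilting.isHomologicalRingEpi_of_arisesFrom h⟩
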